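/- Conventions. A computable structure is a structure in a computable vocabulary (computable sets of function and relation symbols with computable arity functions) whose domain is a computable subset of $\omega$ and whose functions and relations are uniformly computable. A computable copy of $\mathcal A$ is a computable structure isomorphic to $\mathcal A$. The categoricity spectrum of a computable structure $\mathcal A$ is \[ \mathrm{CatSpec}(\mathcal A)=\bigcap_{\mathcal B\cong\mathcal A,\ \mathcal B \text{ computable}}\{\deg(X): X\subseteq\omega,\ (\exists f:\mathcal A\cong\mathcal B)\ f\le_T X\}, \] and a Turing degree $\mathbf d$ is the degree of categoricity of $\mathcal A$ if it is the least element of $\mathrm{CatSpec}(\mathcal A)$. A Turing degree $\mathbf d$ is a strong degree of categoricity if there is a computable structure $\mathcal A$ with computable copies $\mathcal A_0,\mathcal A_1$ such that $\mathbf d$ is the degree of categoricity of $\mathcal A$ and every isomorphism $f:\mathcal A_0\to\mathcal A_1$ satisfies $\deg(f)\ge\mathbf d$. A set $X\subseteq\omega$ is a $\Pi^0_4$ singleton if it is the only solution of a (lightface) $\Pi^0_4$ predicate of sets, that is, there is a computable relation $R$ such that for all $Y\subseteq\omega$: $Y=X \iff \forall a\,\exists b\,\forall c\,\exists e\; R(a,b,c,e,Y)$.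 Proposition. Every strong degree of categoricity contains a $\Pi^0_4$ singleton: if $\mathbf d$ is a strong degree of categoricity, then there is a set $X\subseteq\omega$ with $\deg(X)=\mathbf d$ that is a $\Pi^0_4$ singleton. -/

import Mathlib

/-! ## Turing degrees of total functions and of sets -/

/-- The Turing degree of a total function. -/
def degFun (f : ℕ → ℕ) : TuringDegree :=
  toAntisymmetrization TuringReducible (fun n => Part.some (f n))

open Classical in
/-- The characteristic function of a set of natural numbers. -/
noncomputable def charFun (X : Set ℕ) (n : ℕ) : ℕ := if n ∈ X then 1 else 0

/-- The Turing degree of a set of natural numbers. -/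
noncomputable def degSet (X : Set ℕ) : TuringDegree := degFun (charFun X)

/-- The order of Mathlib's Turing degrees is Turing reducibility. -/
theorem degFun_le_degFun {f g : ℕ → ℕ} :
    degFun f ≤ degFun g ↔
      TuringReducible (fun n => Part.some (f n)) (fun n => Part.some (g n)) :=
  Iff.rfl

/-! ## Computable structures -/

/-- A computable vocabulary: computable sets of function symbols and of relation symbols (natural
numbers), with computable arity functions. Constants are function symbols of arity `0`. -/
structure ComputableVocabulary where
  funSymb : Set ℕ
  relSymb : Set ℕ
  funArity : ℕ → ℕ
  relArity : ℕ → ℕ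
  computable_funSymb : ComputablePred (fun s => s ∈ funSymb)
  computable_relSymb : ComputablePred (fun s => s ∈ relSymb)
  computable_funArity : Computable funArity
  computable_relArity : Computable relArity

/-- The first-order language of a computable vocabulary. -/
def ComputableVocabulary.lang (V : ComputableVocabulary) : FirstOrder.Language.{0, 0} where
  Functions n := {s : ℕ // s ∈ V.funSymb ∧ V.funArity s = n}
  Relations n := {s : ℕ // s ∈ V.relSymb ∧ V.relArity s = n}

/-- A computable structure in the vocabulary `V`: its domain is a computable set of natural
numbers, and its functions and relations are computable uniformly in the symbol. -/
structure ComputableStructure (V : ComputableVocabulary) where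
  carrier : Set ℕ
  computable_carrier : ComputablePred (fun n => n ∈ carrier)
  str : V.lang.Structure carrier
  computable_fun : ∃ F : ℕ → List ℕ → ℕ, Computable₂ F ∧
    ∀ (n : ℕ) (s : V.lang.Functions n) (x : Fin n → carrier),
      F s.1 (List.ofFn fun i => (x i : ℕ)) = (str.funMap s x : ℕ)
  computable_rel : ∃ R : ℕ → List ℕ → Bool, Computable₂ R ∧
    ∀ (n : ℕ) (s : V.lang.Relations n) (x : Fin n → carrier),
      R s.1 (List.ofFn fun i => (x i : ℕ)) = true ↔ str.RelMap s x

attribute [instance] ComputableStructure.str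

namespace ComputableStructure

variable {V : ComputableVocabulary}

/-- Isomorphisms between computable structures (Mathlib's first-order isomorphisms). -/
abbrev Iso (A B : ComputableStructure V) : Type :=
  V.lang.Equiv A.carrier B.carrier

open Classical in
/-- An isomorphism `f : A → B` as a total function on `ℕ`. It takes the value `0` off the domain
of `A`; since that domain is computable, this does not change the Turing degree of `f`. -/
noncomputable def Iso.toNatFun {A B : ComputableStructure V} (f : A.Iso B) (n : ℕ) : ℕ :=
  if h : n ∈ A.carrier then (f ⟨n, h⟩ : ℕ) else 0

/-- The categoricity spectrum of `A`: the degrees that, for every computable copy `B` of `A`,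
compute an isomorphism from `A` to `B`. -/
def CatSpec (A : ComputableStructure V) : Set TuringDegree :=
  ⋂ (B : ComputableStructure V) (_ : Nonempty (A.Iso B)),
    {d | ∃ X : Set ℕ, degSet X = d ∧ ∃ f : A.Iso B, degFun f.toNatFun ≤ degSet X}

/-- `d` is the degree of categoricity of `A`. -/
def IsDegreeOfCategoricity (A : ComputableStructure V) (d : TuringDegree) : Prop :=
  IsLeast A.CatSpec d

end ComputableStructure

/-- `d` is a strong degree of categoricity: it is the degree of categoricity of a computable
structure `A` with computable copies `A₀`, `A₁` such that every isomorphism from `A₀` to `A₁`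
computes `d`. -/
def IsStrongDegreeOfCategoricity (d : TuringDegree) : Prop :=
  ∃ (V : ComputableVocabulary) (A A₀ A₁ : ComputableStructure V),
    Nonempty (A.Iso A₀) ∧ Nonempty (A.Iso A₁) ∧ A.IsDegreeOfCategoricity d ∧
      ∀ f : A₀.Iso A₁, d ≤ degFun f.toNatFun

/-! ## The (lightface) arithmetical hierarchy for predicates of sets -/

open Classical in
/-- The string `X(0) X(1) … X(k-1)`. -/
noncomputable def initSeg (X : Set ℕ) (k : ℕ) : List Bool :=
  (List.range k).map fun i => decide (i ∈ X)

/-- `P(x, X)` is a computable predicate of a number `x` and a set `X`: a total Turing functional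
decides it. The functional is given by a computable `φ`, where `φ x σ` is the output (if any) on
input `x` that has been found from the finite part `σ` of the oracle. -/
def IsComputableRel (P : ℕ → Set ℕ → Prop) : Prop :=
  ∃ φ : ℕ → List Bool → Option Bool, Computable₂ φ ∧ ∀ x X,
    (∃ k b, φ x (initSeg X k) = some b) ∧
      ∀ k b, φ x (initSeg X k) = some b → (b = true ↔ P x X)

mutual

/-- `P(x, X)` is a `Σ⁰ₙ` predicate. -/
def IsSigmaRel : ℕ → (ℕ → Set ℕ → Prop) → Prop
  | 0, P => IsComputableRel P
  | n + 1, P => ∃ Q, IsPiRel n Q ∧ ∀ x X, P x X ↔ ∃ m, Q (Nat.pair x m) X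

/-- `P(x, X)` is a `Π⁰ₙ` predicate. -/
def IsPiRel : ℕ → (ℕ → Set ℕ → Prop) → Prop
  | 0, P => IsComputableRel P
  | n + 1, P => ∃ Q, IsSigmaRel n Q ∧ ∀ x X, P x X ↔ ∀ m, Q (Nat.pair x m) X

end

/-- `X` is a `Π⁰ₙ` singleton: the only solution of a `Π⁰ₙ` predicate of sets (which does not
depend on its number argument). -/
def IsPiSingleton (n : ℕ) (X : Set ℕ) : Prop :=
  ∃ P : Set ℕ → Prop, IsPiRel n (fun _ Y => P Y) ∧ ∀ Y, P Y ↔ Y = X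

-- Let `A₀`, `A₁` be copies all of whose isomorphisms compute `d`, and let `X` have degree `d`. An
-- isomorphism coded together with its inverse is subject to universal conditions only (surjectivity
-- needs no search), so these codes form a `Π⁰₁` class `C` in Baire space. Every element of `C`
-- computes `X`, and some element is computable from `X`.
--
-- Let `K` be the set of elements of `C` computable from `X`. Different elements of `C` may compute
-- `X` by different programs; Baire category makes the program uniform. The closure of `K` is Polish
-- and contained in `C`, so it is covered by countably many sets, one for each program, and one of
-- these is dense in a cylinder meeting `K` (`exists_program_dense`). Once `C` is cut down to that
-- cylinder, a single program `c` never errs on the elements of `C` computable from `X`, and for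
-- each `n` it outputs `X(n)` on at least one of them.
--
-- Then `X` is the only `Y` such that a fixed program with oracle `Y` enumerates an element of `C`,
-- and whenever any program with oracle `Y` enumerates an element of `C`, the outputs of `c` on that
-- element agree with `Y`. The first clause makes `Y` compute `X`, hence every element of `K`; the
-- second then forces `Y = X` (`isPiSingleton_of_treeClass`). Enumerating an element of `C` is a
-- `∀∃` condition, so the whole condition is `∀∃∀`; an idle quantifier puts it in `Π⁰₄` form.

open Filter

-- Oracle computations through finite strings

/-- The string `g(0) g(1) … g(k-1)`. -/
def initList (g : ℕ → ℕ) (k : ℕ) : List ℕ := (List.range k).map g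

@[simp] theorem length_initList (g : ℕ → ℕ) (k : ℕ) : (initList g k).length = k := by
  simp [initList]

theorem take_initList (g : ℕ → ℕ) (j k : ℕ) :
    (initList g k).take j = initList g (min j k) := by
  simp [initList, ← List.map_take, List.take_range]

theorem getElem?_initList {g : ℕ → ℕ} {n k : ℕ} (h : n < k) : (initList g k)[n]? = some (g n) := by
  simp [initList, h]

theorem getElem?_initList_eq_some {g : ℕ → ℕ} {n k v : ℕ} (h : (initList g k)[n]? = some v) :
    n < k ∧ v = g n := by
  rw [initList, List.getElem?_map, Option.map_eq_some_iff] at h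
  obtain ⟨a, ha, rfl⟩ := h
  obtain ⟨h1, h2⟩ := List.getElem?_eq_some_iff.1 ha
  simp at h1 h2
  exact ⟨h1, by rw [h2]⟩

/-- Every function recursive in `g` is approximated by a partial recursive functional of finite
initial segments of `g`. -/
theorem exists_partrec_initList_of_recursiveIn {g : ℕ → ℕ} {f : ℕ →. ℕ}
    (hf : Nat.RecursiveIn {fun n => Part.some (g n)} f) :
    ∃ F : ℕ × List ℕ →. ℕ, Partrec F ∧
      (∀ n v, v ∈ f n → ∀ᶠ k in atTop, v ∈ F (n, initList g k)) ∧
      ∀ n k v, v ∈ F (n, initList g k) → v ∈ f n := by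
  -- Convergence is carried as "for all large `k`", so that two subcomputations, or the finitely
  -- many tested by `rfind`, converge on a common string.
  induction hf with
  | zero =>
    exact ⟨fun _ => Part.some 0, (Computable.const 0).partrec,
      fun n v h => .of_forall fun _ => h, fun n k v h => h⟩
  | succ =>
    exact ⟨fun p => Part.some (p.1 + 1), (Computable.succ.comp Computable.fst).partrec,
      fun n v h => .of_forall fun _ => h, fun n k v h => h⟩
  | left =>
    exact ⟨fun p => Part.some p.1.unpair.1,
      (Computable.fst.comp (Computable.unpair.comp Computable.fst)).partrec,
      fun n v h => .of_forall fun _ => h, fun n k v h => h⟩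
  | right =>
    exact ⟨fun p => Part.some p.1.unpair.2,
      (Computable.snd.comp (Computable.unpair.comp Computable.fst)).partrec,
      fun n v h => .of_forall fun _ => h, fun n k v h => h⟩
  | oracle o ho =>
    obtain rfl : o = fun n => Part.some (g n) := ho
    refine ⟨fun p => (p.2[p.1]? : Option ℕ),
      (Computable.list_getElem?.comp Computable.snd Computable.fst).ofOption, ?_, ?_⟩
    · intro n v hv
      filter_upwards [eventually_gt_atTop n] with k hk
      simp only [Part.mem_some_iff] at hv
      simp [getElem?_initList hk, hv]
    · intro n k v hv
      simp only [Part.mem_ofOption, Option.mem_def] at hv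
      simpa using (getElem?_initList_eq_some hv).2
  | @pair f₁ f₂ _ _ ih₁ ih₂ =>
    obtain ⟨F₁, hF₁, hc₁, hs₁⟩ := ih₁
    obtain ⟨F₂, hF₂, hc₂, hs₂⟩ := ih₂
    refine ⟨fun p => (F₁ p).bind fun a => (F₂ p).map fun b => Nat.pair a b,
      hF₁.bind ((hF₂.comp Computable.fst).map
        (Primrec₂.natPair.to_comp.comp (Computable.snd.comp Computable.fst) Computable.snd)),
      ?_, ?_⟩
    · intro n v hv
      simp only [Seq.seq, Part.map_eq_map, Part.mem_bind_iff, Part.mem_map_iff] at hv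
      obtain ⟨_, ⟨a, ha, rfl⟩, b, hb, rfl⟩ := hv
      filter_upwards [hc₁ n a ha, hc₂ n b hb] with k h1 h2
      simp only [Part.mem_bind_iff, Part.mem_map_iff]
      exact ⟨a, h1, b, h2, rfl⟩
    · intro n k v hv
      simp only [Part.mem_bind_iff, Part.mem_map_iff] at hv
      obtain ⟨a, h1, b, h2, rfl⟩ := hv
      simp only [Seq.seq, Part.map_eq_map, Part.mem_bind_iff, Part.mem_map_iff]
      exact ⟨_, ⟨a, hs₁ _ _ _ h1, rfl⟩, b, hs₂ _ _ _ h2, rfl⟩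
  | @comp f₁ f₂ _ _ ih₁ ih₂ =>
    obtain ⟨F₁, hF₁, hc₁, hs₁⟩ := ih₁
    obtain ⟨F₂, hF₂, hc₂, hs₂⟩ := ih₂
    refine ⟨fun p => (F₂ p).bind fun a => F₁ (a, p.2),
      hF₂.bind (hF₁.comp (Computable.snd.pair (Computable.snd.comp Computable.fst))), ?_, ?_⟩
    · intro n v hv
      obtain ⟨a, ha, hv⟩ := Part.mem_bind_iff.1 hv
      filter_upwards [hc₂ n a ha, hc₁ a v hv] with k h1 h2
      exact Part.mem_bind_iff.2 ⟨a, h1, h2⟩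
    · intro n k v hv
      obtain ⟨a, ha, hv⟩ := Part.mem_bind_iff.1 hv
      exact Part.mem_bind_iff.2 ⟨a, hs₂ _ _ _ ha, hs₁ _ _ _ hv⟩
  | @prec f₁ f₂ _ _ ih₁ ih₂ =>
    obtain ⟨F₁, hF₁, hc₁, hs₁⟩ := ih₁
    obtain ⟨F₂, hF₂, hc₂, hs₂⟩ := ih₂
    let F : ℕ × List ℕ →. ℕ := fun p =>
      Nat.rec (motive := fun _ => Part ℕ) (F₁ (p.1.unpair.1, p.2))
        (fun y IH => IH.bind fun i => F₂ (Nat.pair p.1.unpair.1 (Nat.pair y i), p.2)) p.1.unpair.2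
    have hu : Computable fun p : ℕ × List ℕ => p.1.unpair :=
      Computable.unpair.comp Computable.fst
    refine ⟨F, ?_, ?_, ?_⟩
    · have hstep : Partrec₂ fun (p : ℕ × List ℕ) (q : ℕ × ℕ) =>
          F₂ (Nat.pair p.1.unpair.1 (Nat.pair q.1 q.2), p.2) := by
        refine hF₂.comp (Computable.pair ?_ (Computable.snd.comp Computable.fst))
        exact Primrec₂.natPair.to_comp.comp (Computable.fst.comp (hu.comp Computable.fst))
          (Primrec₂.natPair.to_comp.comp (Computable.fst.comp Computable.snd)
            (Computable.snd.comp Computable.snd))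
      exact Partrec.nat_rec (Computable.snd.comp hu)
        (hF₁.comp ((Computable.fst.comp hu).pair Computable.snd)) hstep
    · intro n v hv
      simp only [F]
      simp only at hv
      generalize n.unpair.1 = a, n.unpair.2 = m at hv ⊢
      induction m generalizing v with
      | zero => exact hc₁ _ _ hv
      | succ m ih =>
        obtain ⟨i, hi, hv⟩ := Part.mem_bind_iff.1 hv
        filter_upwards [ih i hi, hc₂ _ _ hv] with k h1 h2
        exact Part.mem_bind_iff.2 ⟨i, h1, h2⟩
    · intro n k v hv
      simp only [F] at hv
      simp only
      generalize n.unpair.1 = a, n.unpair.2 = m at hv ⊢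
      induction m generalizing v with
      | zero => exact hs₁ _ _ _ hv
      | succ m ih =>
        obtain ⟨i, hi, hv⟩ := Part.mem_bind_iff.1 hv
        exact Part.mem_bind_iff.2 ⟨i, ih i hi, hs₂ _ _ _ hv⟩
  | @rfind f₁ _ ih₁ =>
    obtain ⟨F₁, hF₁, hc₁, hs₁⟩ := ih₁
    refine ⟨fun p => Nat.rfind fun n => (F₁ (Nat.pair p.1 n, p.2)).map fun m => decide (m = 0),
      ?_, ?_, ?_⟩
    · refine Partrec.rfind (Partrec.map (hF₁.comp (Computable.pair
        (Primrec₂.natPair.to_comp.comp (Computable.fst.comp Computable.fst) Computable.snd)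
        (Computable.snd.comp Computable.fst))) ?_)
      exact (Primrec.eq.decide.comp Primrec.snd (Primrec.const 0)).to_comp
    · intro n v hv
      obtain ⟨hv, hlt⟩ := Nat.mem_rfind.1 hv
      obtain ⟨m, hm, hm0⟩ := (Part.mem_map_iff _).1 hv
      have : ∀ᶠ k in atTop, ∀ j ∈ Set.Iio v,
          ∃ m, m ∈ F₁ (Nat.pair n j, initList g k) ∧ decide (m = 0) = false := by
        refine (eventually_all_finite (Set.finite_Iio v)).2 fun j hj => ?_
        obtain ⟨m, hm, hm0⟩ := (Part.mem_map_iff _).1 (hlt hj)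
        filter_upwards [hc₁ _ _ hm] with k hk using ⟨m, hk, hm0⟩
      filter_upwards [hc₁ _ _ hm, this] with k h1 h2
      exact Nat.mem_rfind.2 ⟨(Part.mem_map_iff _).2 ⟨m, h1, hm0⟩,
        fun {j} hj => (Part.mem_map_iff _).2 (h2 j hj)⟩
    · intro n k v hv
      obtain ⟨hv, hlt⟩ := Nat.mem_rfind.1 hv
      obtain ⟨m, hm, hm0⟩ := (Part.mem_map_iff _).1 hv
      refine Nat.mem_rfind.2 ⟨(Part.mem_map_iff _).2 ⟨m, hs₁ _ _ _ hm, hm0⟩, fun {j} hj => ?_⟩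
      obtain ⟨m, hm, hm0⟩ := (Part.mem_map_iff _).1 (hlt hj)
      exact (Part.mem_map_iff _).2 ⟨m, hs₁ _ _ _ hm, hm0⟩

/-- A universal oracle machine: the output, if any, of the `i`-th program on input `n`, when run
with the finite part `ρ` of its oracle. The length of `ρ` codes how much of `ρ` the program sees
and for how many steps it runs. -/
def oracleEval (i n : ℕ) (ρ : List ℕ) : Option ℕ :=
  Nat.Partrec.Code.evaln ρ.length.unpair.2 (Denumerable.ofNat Nat.Partrec.Code i)
    (Nat.pair n (Encodable.encode (ρ.take ρ.length.unpair.1)))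

theorem primrec_oracleEval :
    Primrec fun p : (ℕ × ℕ) × List ℕ => oracleEval p.1.1 p.1.2 p.2 := by
  have hl : Primrec fun p : (ℕ × ℕ) × List ℕ => p.2.length.unpair :=
    Primrec.unpair.comp (Primrec.list_length.comp Primrec.snd)
  exact Nat.Partrec.Code.primrec_evaln.comp
    (((Primrec.snd.comp hl).pair ((Primrec.ofNat _).comp (Primrec.fst.comp Primrec.fst))).pair
      (Primrec₂.natPair.comp (Primrec.snd.comp Primrec.fst)
        (Primrec.encode.comp (Primrec.list_take.comp (Primrec.fst.comp hl) Primrec.snd))))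

/-- The program `i` computes `f` from the oracle `g`. -/
def OracleComputes (i : ℕ) (g f : ℕ → ℕ) : Prop :=
  (∀ n, ∃ k, oracleEval i n (initList g k) = some (f n)) ∧
    ∀ n k v, oracleEval i n (initList g k) = some v → v = f n

theorem exists_oracleComputes {f g : ℕ → ℕ} (h : degFun f ≤ degFun g) :
    ∃ i, OracleComputes i g f := by
  obtain ⟨F, hF, hc, hs⟩ :=
    exists_partrec_initList_of_recursiveIn (RecursiveIn.iff_nat.1 (degFun_le_degFun.1 h))
  obtain ⟨c, hcode⟩ := Nat.Partrec.Code.exists_code.1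
    (Partrec.nat_iff.1 (hF.comp ((Computable.fst.comp Computable.unpair).pair
      ((Primrec.ofNat (List ℕ)).to_comp.comp (Computable.snd.comp Computable.unpair)))))
  have hev : ∀ n ρ, c.eval (Nat.pair n (Encodable.encode ρ)) = F (n, ρ) := by
    intro n ρ
    rw [hcode]
    simp
  refine ⟨Encodable.encode c, fun n => ?_, fun n k v hv => ?_⟩
  · obtain ⟨k, hk⟩ := (hc n (f n) (Part.mem_some _)).exists
    rw [← hev, Nat.Partrec.Code.evaln_complete] at hk
    obtain ⟨t, ht⟩ := hk
    -- `k` is the use and `t` the number of steps; `k ≤ Nat.pair k t`, so a string of this length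
    -- does contain the first `k` values.
    refine ⟨Nat.pair k t, ?_⟩
    simp only [oracleEval, length_initList, Nat.unpair_pair, Denumerable.ofNat_encode,
      take_initList, min_eq_left (Nat.left_le_pair k t)]
    exact ht
  · simp only [oracleEval, length_initList, Denumerable.ofNat_encode, take_initList] at hv
    have := Nat.Partrec.Code.evaln_sound hv
    rw [hev] at this
    simpa using hs _ _ _ this

-- From functionals on strings back to Turing reductions

namespace Nat.RecursiveIn

variable {O : Set (ℕ →. ℕ)} {f h : ℕ → ℕ}

theorem comp_total (hf : Nat.RecursiveIn O fun n => Part.some (f n))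
    (hh : Nat.RecursiveIn O fun n => Part.some (h n)) :
    Nat.RecursiveIn O fun n => Part.some (f (h n)) :=
  (hf.comp hh).of_eq fun _ => Part.bind_some _ _

theorem pair_total (hf : Nat.RecursiveIn O fun n => Part.some (f n))
    (hh : Nat.RecursiveIn O fun n => Part.some (h n)) :
    Nat.RecursiveIn O fun n => Part.some (Nat.pair (f n) (h n)) :=
  (hf.pair hh).of_eq fun n => by simp [Seq.seq]

theorem of_computable (hf : Computable f) : Nat.RecursiveIn O fun n => Part.some (f n) :=
  RecursiveIn.iff_nat.1 hf.partrec.recursiveIn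

theorem prec_total (hf : Nat.RecursiveIn O fun n => Part.some (f n))
    (hh : Nat.RecursiveIn O fun n => Part.some (h n)) :
    Nat.RecursiveIn O fun p => Part.some (Nat.rec (motive := fun _ => ℕ) (f p.unpair.1)
      (fun y i => h (Nat.pair p.unpair.1 (Nat.pair y i))) p.unpair.2) := by
  refine (hf.prec hh).of_eq fun p => ?_
  generalize p.unpair = q
  obtain ⟨a, n⟩ := q
  simp only
  induction n with
  | zero => rfl
  | succ n ih =>
    simp only at ih ⊢
    rw [ih]
    exact Part.bind_some _ _

theorem initList (g : ℕ → ℕ) (hg : Nat.RecursiveIn O fun n => Part.some (g n)) :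
    Nat.RecursiveIn O fun k => Part.some (Encodable.encode (initList g k)) := by
  have hstep : Computable fun p : ℕ =>
      Encodable.encode (Denumerable.ofNat (List ℕ) p.unpair.1 ++ [p.unpair.2]) :=
    (Primrec.encode.comp (Primrec.list_concat.comp
      ((Primrec.ofNat _).comp (Primrec.fst.comp Primrec.unpair))
      (Primrec.snd.comp Primrec.unpair))).to_comp
  have hr : Computable fun p : ℕ => p.unpair.2 := Computable.snd.comp Computable.unpair
  have hl : Computable fun p : ℕ => p.unpair.1 := Computable.fst.comp Computable.unpair
  have hh : Nat.RecursiveIn O fun p => Part.some (Encodable.encode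
      (Denumerable.ofNat (List ℕ) p.unpair.2.unpair.2 ++ [g p.unpair.2.unpair.1])) :=
    ((of_computable hstep).comp_total ((of_computable (hr.comp hr)).pair_total
      (hg.comp_total (of_computable (hl.comp hr))))).of_eq fun p => by simp
  have hf : Nat.RecursiveIn O fun _ => Part.some (Encodable.encode ([] : List ℕ)) :=
    of_computable (Computable.const _)
  refine ((hf.prec_total hh).comp_total (of_computable (Primrec₂.natPair.to_comp.comp
    (Computable.const 0) Computable.id))).of_eq fun k => ?_
  congr 1
  simp only [id, Nat.unpair_pair]
  induction k with
  | zero => simp [_root_.initList]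
  | succ k ih => simp only [ih, Denumerable.ofNat_encode]; simp [_root_.initList, List.range_succ]

end Nat.RecursiveIn

/-- The use principle, from functionals to reductions. -/
theorem degFun_le_of_computable {f g : ℕ → ℕ} {φ : ℕ → List ℕ → Option ℕ} (hφ : Computable₂ φ)
    (hc : ∀ n, ∃ k, φ n (initList g k) = some (f n))
    (hs : ∀ n k v, φ n (initList g k) = some v → v = f n) : degFun f ≤ degFun g := by
  refine degFun_le_degFun.2 (RecursiveIn.iff_nat.2 ?_)
  set O : Set (ℕ →. ℕ) := {fun n => Part.some (g n)}
  have hg : Nat.RecursiveIn O fun n => Part.some (g n) := .oracle _ rfl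
  have hr : Computable fun p : ℕ => p.unpair.2 := Computable.snd.comp Computable.unpair
  have hl : Computable fun p : ℕ => p.unpair.1 := Computable.fst.comp Computable.unpair
  let u : ℕ → ℕ := fun p => Encodable.encode (φ p.unpair.1 (initList g p.unpair.2))
  have hu : Nat.RecursiveIn O fun p => Part.some (u p) := by
    have h1 : Computable fun p : ℕ =>
        Encodable.encode (φ p.unpair.1 (Denumerable.ofNat (List ℕ) p.unpair.2)) :=
      Computable.encode.comp (hφ.comp hl ((Primrec.ofNat _).to_comp.comp hr))
    exact ((Nat.RecursiveIn.of_computable h1).comp_total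
      ((Nat.RecursiveIn.of_computable hl).pair_total
        ((Nat.RecursiveIn.initList g hg).comp_total (.of_computable hr)))).of_eq
      fun p => by simp [u]
  -- `u` is `0` for no output and `v + 1` for output `v`. Thus `1 - u` vanishes exactly when there
  -- is an output, which is what `rfind` searches for, and the predecessor recovers `v`.
  have hsub : Computable fun m : ℕ => 1 - m :=
    (Primrec.nat_sub.comp (Primrec.const 1) Primrec.id).to_comp
  have hfind := ((Nat.RecursiveIn.of_computable hsub).comp_total hu).rfind
  have hpred := (Nat.RecursiveIn.of_computable Computable.pred).comp_total hu
  have hid : Nat.RecursiveIn O fun n => Part.some n := .of_computable Computable.id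
  refine (hpred.comp (hid.pair hfind)).of_eq_tot fun n => ?_
  obtain ⟨k, hk⟩ := hc n
  obtain ⟨j, hj, -⟩ := Nat.rfind_min' (p := fun k => decide (1 - u (Nat.pair n k) = 0)) (m := k)
    (by simp [u, hk])
  have hj1 : 1 - u (Nat.pair n j) = 0 :=
    of_decide_eq_true ((Part.mem_some_iff.1 (Nat.rfind_spec hj)).symm)
  -- The search may stop before `k`; soundness makes any output it meets the right one.
  have hval : u (Nat.pair n j) = f n + 1 := by
    cases hφ' : φ n (initList g j) with
    | none => simp [u, hφ'] at hj1
    | some v => simp [u, hφ', hs n j v hφ']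
  refine Part.mem_bind_iff.2 ⟨Nat.pair n j, ?_, by simp [hval]⟩
  have hmem : ∀ {X : Part ℕ}, j ∈ X → Nat.pair n j ∈ (Nat.pair <$> Part.some n <*> X) :=
    fun {X} hX => by rw [Part.eq_some_iff.2 hX]; simp [Seq.seq]
  exact hmem hj

-- `Π⁰₄` predicates from computable tests on strings

theorem map_initSeg (X : Set ℕ) (k : ℕ) :
    (initSeg X k).map (fun b => cond b 1 0) = initList (charFun X) k := by
  simp only [initSeg, initList, List.map_map]
  refine List.map_congr_left fun i _ => ?_
  by_cases h : i ∈ X <;> simp [charFun, h]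

theorem charFun_injective : Function.Injective charFun := by
  intro X Y h
  ext n
  have := congrFun h n
  by_cases hX : n ∈ X <;> by_cases hY : n ∈ Y <;> simp_all [charFun]

/-- The use is fixed in advance by the number: the functional waits for `z + 1` oracle values. As
`z` will code all quantified variables, and components of a pair are bounded by the pair, this
string is long enough for every stage and position they name. -/
theorem isComputableRel_of_initList {R : ℕ → List ℕ → Bool} (hR : Computable₂ R) :
    IsComputableRel fun z X => R z (initList (charFun X) (z + 1)) = true := by
  refine ⟨fun z σ => if z + 1 ≤ σ.length then
    some (R z ((σ.take (z + 1)).map fun b => cond b 1 0)) else none, ?_, fun z X => ⟨?_, ?_⟩⟩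
  · have h1 : Primrec fun p : ℕ × List Bool => (p.2.take (p.1 + 1)).map fun b => cond b 1 0 :=
      Primrec.list_map (Primrec.list_take.comp (Primrec.succ.comp Primrec.fst) Primrec.snd)
        (Primrec.cond Primrec.snd (Primrec.const 1) (Primrec.const 0))
    have h2 : Primrec fun p : ℕ × List Bool => decide (p.1 + 1 ≤ p.2.length) :=
      Primrec.nat_le.decide.comp (Primrec.succ.comp Primrec.fst)
        (Primrec.list_length.comp Primrec.snd)
    refine (Computable.cond h2.to_comp
      (Computable.option_some.comp (hR.comp Computable.fst h1.to_comp))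
      (Computable.const none)).of_eq fun p => ?_
    by_cases h : p.1 + 1 ≤ p.2.length <;> simp [h]
  · exact ⟨z + 1, _, if_pos (by simp [initSeg])⟩
  · intro k b h
    dsimp only at h
    split_ifs at h with hk
    have hk' : z + 1 ≤ k := by simpa [initSeg] using hk
    rw [List.map_take, map_initSeg, take_initList, min_eq_left hk', Option.some_inj] at h
    subst h
    exact Iff.rfl

theorem isPiRel_four {R : ℕ → List ℕ → Bool} (hR : Computable₂ R) :
    IsPiRel 4 fun x X => ∀ p, ∃ q, ∀ r, ∃ u,
      R (Nat.pair (Nat.pair (Nat.pair (Nat.pair x p) q) r) u)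
        (initList (charFun X) (Nat.pair (Nat.pair (Nat.pair (Nat.pair x p) q) r) u + 1)) = true := by
  simp only [IsPiRel, IsSigmaRel]
  exact ⟨_, ⟨_, ⟨fun z X => ∃ u, R (Nat.pair z u) (initList (charFun X) (Nat.pair z u + 1)) = true,
    ⟨_, isComputableRel_of_initList hR, fun _ _ => Iff.rfl⟩, fun _ _ => Iff.rfl⟩,
    fun _ _ => Iff.rfl⟩, fun _ _ => Iff.rfl⟩

-- Enumerating elements of a `Π⁰₁` class from an oracle

/-- The list of numbers output at stage `s` by the `i`-th program with oracle string `σ`. -/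
def oracleList (i s : ℕ) (σ : List ℕ) : List ℕ :=
  Denumerable.ofNat (List ℕ) ((oracleEval i s.unpair.1 (σ.take s.unpair.2)).getD 0)

theorem oracleList_initList {i s N : ℕ} (g : ℕ → ℕ) (h : s ≤ N) :
    oracleList i s (initList g N) = oracleList i s (initList g s) := by
  simp only [oracleList, take_initList, min_eq_left (Nat.unpair_right_le s),
    min_eq_left ((Nat.unpair_right_le s).trans h)]

theorem computable_oracleEval {α : Type*} [Primcodable α] {i n : α → ℕ} {ρ : α → List ℕ}
    (hi : Computable i) (hn : Computable n) (hρ : Computable ρ) :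
    Computable fun a => oracleEval (i a) (n a) (ρ a) :=
  primrec_oracleEval.to_comp.comp ((hi.pair hn).pair hρ)

theorem computable_oracleList {α : Type*} [Primcodable α] {i s : α → ℕ} {σ : α → List ℕ}
    (hi : Computable i) (hs : Computable s) (hσ : Computable σ) :
    Computable fun a => oracleList (i a) (s a) (σ a) :=
  (Primrec.ofNat _).to_comp.comp (Computable.option_getD
    (computable_oracleEval hi (Computable.fst.comp (Computable.unpair.comp hs))
      (Primrec.list_take.to_comp.comp (Computable.snd.comp (Computable.unpair.comp hs)) hσ))
    (Computable.const 0))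

/-- With oracle `o`, the `i`-th program lists arbitrarily long initial segments of `g`, and
nothing else. -/
def Enumerates (i : ℕ) (o g : ℕ → ℕ) : Prop :=
  (∀ x, ∃ s, x ≤ (oracleList i s (initList o s)).length) ∧
    ∀ s, oracleList i s (initList o s) = initList g (oracleList i s (initList o s)).length

/-- The program is one computing the code of `initList g x` from `x`; stage `Nat.pair x k` runs it
on `x` with a string of length `k`. -/
theorem exists_enumerates {o g : ℕ → ℕ} (h : degFun g ≤ degFun o) : ∃ i, Enumerates i o g := by
  have h' : degFun (fun k => Encodable.encode (initList g k)) ≤ degFun o :=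
    le_trans (degFun_le_degFun.2 (RecursiveIn.iff_nat.2
      (Nat.RecursiveIn.initList g (.oracle _ rfl)))) h
  obtain ⟨i, hc, hs⟩ := exists_oracleComputes h'
  refine ⟨i, fun x => ?_, fun s => ?_⟩
  · obtain ⟨k, hk⟩ := hc x
    refine ⟨Nat.pair x k, ?_⟩
    simp [oracleList, take_initList, min_eq_left (Nat.right_le_pair x k), hk]
  · simp only [oracleList, take_initList, min_eq_left (Nat.unpair_right_le s)]
    cases hv : oracleEval i s.unpair.1 (initList o s.unpair.2) with
    | none =>
      -- A stage without output gets the default code `0`, that is, the empty list, an initial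
      -- segment of every function.
      have : Denumerable.ofNat (List ℕ) 0 = [] := Denumerable.ofNat_encode ([] : List ℕ)
      simp [this, initList]
    | some v => simp [hs _ _ _ hv]

theorem Enumerates.degFun_le {i : ℕ} {o g : ℕ → ℕ} (h : Enumerates i o g) :
    degFun g ≤ degFun o := by
  refine degFun_le_of_computable (φ := fun n σ => (oracleList i σ.length σ)[n]?) ?_ ?_ ?_
  · exact Computable.list_getElem?.comp (computable_oracleList (Computable.const i)
      (Computable.list_length.comp Computable.snd) Computable.snd) Computable.fst
  · intro n
    obtain ⟨s, hs⟩ := h.1 (n + 1)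
    refine ⟨s, ?_⟩
    rw [length_initList, h.2 s]
    exact getElem?_initList hs
  · intro n k v hv
    rw [length_initList, h.2 k] at hv
    exact (getElem?_initList_eq_some hv).2

/-- The closed set of functions all of whose initial segments pass the tests `D`. -/
def treeClass (D : ℕ → List ℕ → Bool) : Set (ℕ → ℕ) :=
  {g | ∀ m k, D m (initList g k) = true}

/-- A test for `i` to enumerate an element of `treeClass D`. The number `x` codes the conditions
to be checked, and `s` is a stage at which a long enough initial segment has been listed. -/
def enumTest (D : ℕ → List ℕ → Bool) (i x s : ℕ) (σ : List ℕ) : Bool :=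
  decide (x.unpair.1 ≤ (oracleList i s σ).length) &&
    (D x.unpair.2.unpair.1 ((oracleList i x.unpair.2.unpair.2.unpair.1 σ).take x.unpair.1) &&
    decide ((oracleList i x.unpair.2.unpair.2.unpair.1 σ).take
        (oracleList i x.unpair.2.unpair.2.unpair.2 σ).length =
      (oracleList i x.unpair.2.unpair.2.unpair.2 σ).take
        (oracleList i x.unpair.2.unpair.2.unpair.1 σ).length))

theorem computable_enumTest {D : ℕ → List ℕ → Bool} (hD : Computable₂ D) {α : Type*}
    [Primcodable α] {i x s : α → ℕ} {σ : α → List ℕ} (hi : Computable i) (hx : Computable x)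
    (hs : Computable s) (hσ : Computable σ) :
    Computable fun a => enumTest D (i a) (x a) (s a) (σ a) := by
  have hl {f : α → ℕ} (hf : Computable f) : Computable fun a => (f a).unpair.1 :=
    Computable.fst.comp (Computable.unpair.comp hf)
  have hr {f : α → ℕ} (hf : Computable f) : Computable fun a => (f a).unpair.2 :=
    Computable.snd.comp (Computable.unpair.comp hf)
  have h1 := computable_oracleList hi (hl (hr (hr hx))) hσ
  have h2 := computable_oracleList hi (hr (hr (hr hx))) hσ
  refine Primrec.and.to_comp.comp ?_ (Primrec.and.to_comp.comp ?_ ?_)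
  · exact Primrec.nat_le.decide.to_comp.comp (hl hx)
      (Computable.list_length.comp (computable_oracleList hi hs hσ))
  · exact hD.comp (hl (hr hx)) (Primrec.list_take.to_comp.comp (hl hx) h1)
  · exact Primrec.eq.decide.to_comp.comp
      (Primrec.list_take.to_comp.comp (Computable.list_length.comp h2) h1)
      (Primrec.list_take.to_comp.comp (Computable.list_length.comp h1) h2)

theorem enumTest_initList {D : ℕ → List ℕ → Bool} {i x s N : ℕ} {o : ℕ → ℕ} (hx : x ≤ N)
    (hs : s ≤ N) : enumTest D i x s (initList o N) = true ↔
      x.unpair.1 ≤ (oracleList i s (initList o s)).length ∧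
      D x.unpair.2.unpair.1 ((oracleList i x.unpair.2.unpair.2.unpair.1
        (initList o x.unpair.2.unpair.2.unpair.1)).take x.unpair.1) = true ∧
      (oracleList i x.unpair.2.unpair.2.unpair.1
        (initList o x.unpair.2.unpair.2.unpair.1)).take
        (oracleList i x.unpair.2.unpair.2.unpair.2
          (initList o x.unpair.2.unpair.2.unpair.2)).length =
      (oracleList i x.unpair.2.unpair.2.unpair.2
        (initList o x.unpair.2.unpair.2.unpair.2)).take
        (oracleList i x.unpair.2.unpair.2.unpair.1
          (initList o x.unpair.2.unpair.2.unpair.1)).length := by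
  have h := ((Nat.unpair_right_le x.unpair.2).trans (Nat.unpair_right_le x)).trans hx
  simp only [enumTest, Bool.and_eq_true, decide_eq_true_eq, oracleList_initList o hs,
    oracleList_initList o ((Nat.unpair_left_le _).trans h),
    oracleList_initList o ((Nat.unpair_right_le _).trans h)]

/-- This is where enumerating an element of the class becomes a `∀∃` condition. For `x = ⟨j, ⟨m, ⟨s,
t⟩⟩⟩` the test asks for a list of length at least `j`, for `D m` on the first `j` entries listed at
stage `s`, and for compatibility of the lists at stages `s` and `t`. Only the first needs a search.
Long, pairwise compatible lists glue to a function. -/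
theorem forall_exists_enumTest_iff {D : ℕ → List ℕ → Bool} {i : ℕ} {o : ℕ → ℕ} {N : ℕ → ℕ → ℕ}
    (hx : ∀ x s, x ≤ N x s) (hs : ∀ x s, s ≤ N x s) :
    (∀ x, ∃ s, enumTest D i x s (initList o (N x s)) = true) ↔
      ∃ g ∈ treeClass D, Enumerates i o g := by
  simp only [enumTest_initList (hx _ _) (hs _ _)]
  set L : ℕ → List ℕ := fun s => oracleList i s (initList o s) with hL
  constructor
  · intro h
    have h1 (j : ℕ) : ∃ s, j ≤ (L s).length := by
      obtain ⟨s, hs, -⟩ := h (Nat.pair j 0)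
      exact ⟨s, by simpa using hs⟩
    have h2 (j m s : ℕ) : D m ((L s).take j) = true := by
      obtain ⟨-, -, h, -⟩ := h (Nat.pair j (Nat.pair m (Nat.pair s 0)))
      simpa using h
    have h3 (s t : ℕ) : (L s).take (L t).length = (L t).take (L s).length := by
      obtain ⟨-, -, -, h⟩ := h (Nat.pair 0 (Nat.pair 0 (Nat.pair s t)))
      simpa using h
    -- The list at stage `S j` is longer than `j`, so the default value in `g` below is never
    -- reached.
    choose S hS using fun j => h1 (j + 1)
    let g : ℕ → ℕ := fun j => (L (S j)).getD j 0
    have hg (s : ℕ) : L s = initList g (L s).length := by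
      refine List.ext_getElem? fun j => ?_
      by_cases hj : j < (L s).length
      · rw [getElem?_initList hj]
        have h4 := congrArg (·[j]?) (h3 s (S j))
        simp only [List.getElem?_take, if_pos hj, if_pos (Nat.lt_of_succ_le (hS j))] at h4
        rw [h4]
        simp [g, List.getElem?_eq_getElem (Nat.lt_of_succ_le (hS j))]
      · rw [List.getElem?_eq_none (not_lt.1 hj), List.getElem?_eq_none (by simpa using hj)]
    refine ⟨g, fun m k => ?_, h1, hg⟩
    obtain ⟨s, hs⟩ := h1 k
    have := h2 k m s
    rwa [hg, take_initList, min_eq_left hs] at this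
  · rintro ⟨g, hgC, hg1, hg2⟩ x
    obtain ⟨s, hs⟩ := hg1 x.unpair.1
    change ∀ s, L s = initList g (L s).length at hg2
    refine ⟨s, hs, ?_, ?_⟩
    · change D _ ((L _).take _) = true
      rw [hg2, take_initList]
      exact hgC _ _
    · change (L _).take (L _).length = (L _).take (L _).length
      generalize x.unpair.2.unpair.2.unpair.1 = s, x.unpair.2.unpair.2.unpair.2 = t
      have h4 : (L s).take (L t).length = initList g (min (L t).length (L s).length) := by
        conv_lhs => rw [hg2 s, take_initList]
      have h5 : (L t).take (L s).length = initList g (min (L s).length (L t).length) := by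
        conv_lhs => rw [hg2 t, take_initList]
      rw [h4, h5, min_comm]

-- The `Π⁰₄` definition of `X`

/-- If a program computes `X` from sufficiently many elements of a `Π⁰₁` class, all of which
compute `X`, and if it is never wrong on the elements computable from `X`, then `X` is a
`Π⁰₄` singleton. -/
theorem isPiSingleton_of_treeClass {D : ℕ → List ℕ → Bool} (hD : Computable₂ D) {X : Set ℕ}
    {h : ℕ → ℕ} (hC : h ∈ treeClass D) (hX : degFun h ≤ degSet X)
    (hle : ∀ g ∈ treeClass D, degSet X ≤ degFun g) (c : ℕ)
    (hsound : ∀ g ∈ treeClass D, degFun g ≤ degSet X → ∀ n k v,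
      oracleEval c n (initList g k) = some v → v = charFun X n)
    (hcomplete : ∀ n, ∃ g ∈ treeClass D, degFun g ≤ degSet X ∧
      ∃ k, oracleEval c n (initList g k) = some (charFun X n)) :
    IsPiSingleton 4 X := by
  obtain ⟨a, ha⟩ := exists_enumerates hX
  let T : ℕ → ℕ → ℕ → ℕ → List ℕ → Bool := fun i n s k σ =>
    decide (oracleEval c n ((oracleList i s σ).take k) = none) ||
      decide (oracleEval c n ((oracleList i s σ).take k) = σ[n]?)
  -- Here `p = ⟨x, ⟨⟨i, n⟩, ⟨s, k⟩⟩⟩` and `q = ⟨y, t⟩`. The matrix says that program `a` meets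
  -- condition `x` at stage `t`, and that either `c` on input `n` with the first `k` values listed
  -- by `i` at stage `s` does not contradict the oracle, or `i` fails condition `y` at stage `r`.
  let R : ℕ → List ℕ → Bool := fun z σ =>
    let r := z.unpair.1.unpair.2
    let q := z.unpair.1.unpair.1.unpair.2
    let p := z.unpair.1.unpair.1.unpair.1.unpair.2
    let w := p.unpair.2
    enumTest D a p.unpair.1 q.unpair.2 σ &&
      (T w.unpair.1.unpair.1 w.unpair.1.unpair.2 w.unpair.2.unpair.1 w.unpair.2.unpair.2 σ ||
        !enumTest D w.unpair.1.unpair.1 q.unpair.1 r σ)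
  have hR : Computable₂ R := by
    have hl {f : ℕ × List ℕ → ℕ} (hf : Computable f) : Computable fun a => (f a).unpair.1 :=
      Computable.fst.comp (Computable.unpair.comp hf)
    have hr {f : ℕ × List ℕ → ℕ} (hf : Computable f) : Computable fun a => (f a).unpair.2 :=
      Computable.snd.comp (Computable.unpair.comp hf)
    have hz : Computable fun a : ℕ × List ℕ => a.1 := Computable.fst
    have hσ : Computable fun a : ℕ × List ℕ => a.2 := Computable.snd
    have hr' := hr (hl hz)
    have hq' := hr (hl (hl hz))
    have hp' := hr (hl (hl (hl hz)))
    have hw' := hr hp'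
    have hev := computable_oracleEval (Computable.const c) (hr (hl hw'))
      (Primrec.list_take.to_comp.comp (hr (hr hw'))
        (computable_oracleList (hl (hl hw')) (hl (hr hw')) hσ))
    refine Primrec.and.to_comp.comp (computable_enumTest hD (Computable.const a) (hl hp')
      (hr hq') hσ) (Primrec.or.to_comp.comp (Primrec.or.to_comp.comp ?_ ?_)
        (Primrec.not.to_comp.comp (computable_enumTest hD (hl (hl hw')) (hl hq') hr' hσ)))
    · exact Primrec.eq.decide.to_comp.comp hev (Computable.const none)
    · exact Primrec.eq.decide.to_comp.comp hev (Computable.list_getElem?.comp hσ (hr (hl hw')))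
  have key : ∀ x Y, (∀ p, ∃ q, ∀ r, ∃ u,
      R (Nat.pair (Nat.pair (Nat.pair (Nat.pair x p) q) r) u) (initList (charFun Y)
        (Nat.pair (Nat.pair (Nat.pair (Nat.pair x p) q) r) u + 1)) = true) ↔ Y = X := by
    intro x Y
    set o := charFun Y
    -- A canonical string length; any length bounding `x` and `s` gives the same verdict.
    let E : ℕ → ℕ → ℕ → Prop := fun i x s => enumTest D i x s (initList o (max x s)) = true
    have hE {i x s N : ℕ} (hx : x ≤ N) (hs : s ≤ N) :
        enumTest D i x s (initList o N) = true ↔ E i x s :=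
      (enumTest_initList hx hs).trans
        (enumTest_initList (le_max_left x s) (le_max_right x s)).symm
    have hG (i : ℕ) : (∀ x, ∃ s, E i x s) ↔ ∃ g ∈ treeClass D, Enumerates i o g :=
      forall_exists_enumTest_iff (N := max) le_max_left le_max_right
    let ok : ℕ → ℕ → ℕ → ℕ → Prop := fun i n s k =>
      oracleEval c n ((oracleList i s (initList o s)).take k) = none ∨
        oracleEval c n ((oracleList i s (initList o s)).take k) = some (o n)
    have hT {i n s k N : ℕ} (hn : n < N) (hs : s ≤ N) :
        T i n s k (initList o N) = true ↔ ok i n s k := by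
      simp only [T, ok, Bool.or_eq_true, decide_eq_true_eq, oracleList_initList o hs,
        getElem?_initList hn]
    have hR2 (p q r u : ℕ) : R (Nat.pair (Nat.pair (Nat.pair (Nat.pair x p) q) r) u)
        (initList o (Nat.pair (Nat.pair (Nat.pair (Nat.pair x p) q) r) u + 1)) = true ↔
        E a p.unpair.1 q.unpair.2 ∧ (ok p.unpair.2.unpair.1.unpair.1 p.unpair.2.unpair.1.unpair.2
          p.unpair.2.unpair.2.unpair.1 p.unpair.2.unpair.2.unpair.2 ∨
          ¬ E p.unpair.2.unpair.1.unpair.1 q.unpair.1 r) := by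
      have hr1 := Nat.left_le_pair (Nat.pair (Nat.pair (Nat.pair x p) q) r) u
      have hr2 := (Nat.right_le_pair _ _).trans hr1
      have hq1 := (Nat.left_le_pair _ _).trans hr1
      have hq2 := (Nat.right_le_pair _ _).trans hq1
      have hp2 := (Nat.right_le_pair _ _).trans ((Nat.left_le_pair _ _).trans hq1)
      have hl {y z : ℕ} (h : y ≤ z) : y.unpair.1 ≤ z := (Nat.unpair_left_le y).trans h
      have hr {y z : ℕ} (h : y ≤ z) : y.unpair.2 ≤ z := (Nat.unpair_right_le y).trans h
      simp only [R, Nat.unpair_pair, Bool.and_eq_true, Bool.or_eq_true, Bool.not_eq_true',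
        ← Bool.not_eq_true]
      rw [hE (Nat.le_succ_of_le (hl hp2)) (Nat.le_succ_of_le (hr hq2)),
        hE (Nat.le_succ_of_le (hl hq2)) (Nat.le_succ_of_le hr2),
        hT (Nat.lt_succ_of_le (hr (hl (hr hp2)))) (Nat.le_succ_of_le (hl (hr (hr hp2))))]
    -- The matrix does not depend on `u`, so the innermost quantifier disappears.
    simp only [hR2, exists_const]
    constructor
    · intro H
      have hXY : degSet X ≤ degSet Y := by
        obtain ⟨g, hgC, hg⟩ := (hG a).1 fun x => by
          obtain ⟨q, hq⟩ := H (Nat.pair x 0)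
          exact ⟨_, by simpa using (hq 0).1⟩
        exact (hle g hgC).trans hg.degFun_le
      refine charFun_injective (funext fun n => ?_)
      obtain ⟨g, hgC, hgX, k, hk⟩ := hcomplete n
      -- As `Y` computes `X`, the witness for `n` is among the functions enumerated from `Y`, so the
      -- value of `c` on it must be both `X(n)` and `Y(n)`.
      obtain ⟨i, hi⟩ := exists_enumerates (hgX.trans hXY)
      obtain ⟨s, hs⟩ := hi.1 k
      obtain ⟨q, hq⟩ := H (Nat.pair 0 (Nat.pair (Nat.pair i n) (Nat.pair s k)))
      simp only [Nat.unpair_pair] at hq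
      have htake : (oracleList i s (initList o s)).take k = initList g k := by
        rw [hi.2 s, take_initList, min_eq_left hs]
      by_cases hok : ok i n s k
      · simp only [ok, htake, hk, reduceCtorEq, false_or, Option.some_inj] at hok
        exact hok.symm
      · obtain ⟨r, hr⟩ := (hG i).2 ⟨g, hgC, hi⟩ q.unpair.1
        exact absurd hr ((hq r).2.resolve_left hok)
    · rintro rfl p
      obtain ⟨s', hs'⟩ := (hG a).2 ⟨h, hC, ha⟩ p.unpair.1
      generalize p.unpair.2.unpair.1.unpair.1 = i, p.unpair.2.unpair.1.unpair.2 = n,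
        p.unpair.2.unpair.2.unpair.1 = s, p.unpair.2.unpair.2.unpair.2 = k
      by_cases hok : ok i n s k
      · exact ⟨Nat.pair 0 s', fun r => ⟨by simpa using hs', .inl hok⟩⟩
      -- If `i` did enumerate an element of the class, that element would be computable from `X` and
      -- `c` would be right on it. Hence some condition is never met, and it is the first component
      -- of `q`.
      · by_cases hi : ∀ x, ∃ s, E i x s
        · obtain ⟨g, hgC, hg⟩ := (hG i).1 hi
          refine absurd ?_ hok
          simp only [ok]
          rw [hg.2 s, take_initList]
          cases hv : oracleEval c n (initList g (min k (oracleList i s (initList o s)).length)) with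
          | none => exact .inl rfl
          | some v => exact .inr (congrArg some (hsound g hgC hg.degFun_le _ _ _ hv))
        · push Not at hi
          obtain ⟨x, hx⟩ := hi
          exact ⟨Nat.pair x s', fun r => ⟨by simpa using hs', .inr (by simpa using hx r)⟩⟩
  refine ⟨(· = X), ?_, fun Y => Iff.rfl⟩
  have := isPiRel_four hR
  simpa only [key] using this

-- Baire category and a uniform program

theorem initList_eq_of_mem_cylinder {g g' : ℕ → ℕ} {k : ℕ}
    (h : g' ∈ PiNat.cylinder (E := fun _ => ℕ) g k) : initList g' k = initList g k :=
  List.map_congr_left fun i hi => h i (List.mem_range.1 hi)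

theorem exists_initList_eq_of_mem_closure {S : Set (ℕ → ℕ)} {g : ℕ → ℕ} (hg : g ∈ closure S)
    (k : ℕ) : ∃ g' ∈ S, initList g' k = initList g k := by
  obtain ⟨g', hg', hS⟩ := mem_closure_iff.1 hg _ (PiNat.isOpen_cylinder (fun _ => ℕ) g k)
    (PiNat.self_mem_cylinder g k)
  exact ⟨g', hS, initList_eq_of_mem_cylinder hg'⟩

/-- The functions agreeing with `p` below `k`, within `treeClass D`, as another such class. -/
theorem exists_treeClass_inter_cylinder {D : ℕ → List ℕ → Bool} (hD : Computable₂ D)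
    (p : ℕ → ℕ) (k : ℕ) : ∃ D' : ℕ → List ℕ → Bool, Computable₂ D' ∧
      ∀ g, g ∈ treeClass D' ↔ g ∈ treeClass D ∧ initList g k = initList p k := by
  -- Both sides are truncated so that strings shorter than `k` are only required to be compatible
  -- with `p`. Only a fixed finite string is involved, so `p` itself need not be computable.
  refine ⟨fun m ρ => D m ρ && decide (ρ.take k = (initList p k).take ρ.length), ?_, fun g => ?_⟩
  · refine Primrec.and.to_comp.comp hD (Primrec.eq.decide.comp (Primrec.list_take.comp
      (Primrec.const k) Primrec.snd) (Primrec.list_take.comp (Primrec.list_length.comp Primrec.snd)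
        (Primrec.const (initList p k)))).to_comp
  · simp only [treeClass, Set.mem_ofPred_eq, Bool.and_eq_true, decide_eq_true_eq, take_initList,
      length_initList]
    refine ⟨fun h => ⟨fun m j => (h m j).1, by simpa using (h 0 k).2⟩,
      fun h => fun m j => ⟨h.1 m j, ?_⟩⟩
    have := congrArg (List.take j) h.2
    simpa only [take_initList, min_comm k j] using this

theorem initList_eq_of_le {g g' : ℕ → ℕ} {j k : ℕ} (h : initList g k = initList g' k)
    (hj : j ≤ k) : initList g j = initList g' j := by
  simpa only [take_initList, min_eq_left hj] using congrArg (List.take j) h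

/-- A Baire category argument: if every element of the closure of `K` computes `f`, then on some
cylinder a single program computes `f` from a set of functions that is dense in `K`. -/
theorem exists_program_dense {K : Set (ℕ → ℕ)} (hK : K.Nonempty) {f : ℕ → ℕ}
    (hf : ∀ g ∈ closure K, ∃ c, OracleComputes c g f) :
    ∃ c k, ∃ p ∈ K, ∀ g ∈ K, initList g k = initList p k →
      g ∈ closure {g | g ∈ closure K ∧ OracleComputes c g f} := by
  have : Nonempty (closure K) := hK.closure.to_subtype
  have : PolishSpace (closure K) := isClosed_closure.polishSpace
  let S : ℕ → Set (closure K) := fun c => {g | OracleComputes c g.1 f}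
  obtain ⟨c, g₀, hg₀⟩ := nonempty_interior_of_iUnion_of_closed (f := fun c => closure (S c))
    (fun _ => isClosed_closure) (Set.eq_univ_of_forall fun g => by
      obtain ⟨c, hc⟩ := hf g.1 g.2
      exact Set.mem_iUnion.2 ⟨c, subset_closure hc⟩)
  obtain ⟨U, hU, hUeq⟩ := isOpen_induced_iff.1 (isOpen_interior (s := closure (S c)))
  have hg₀U : g₀.1 ∈ U := by
    rw [← hUeq] at hg₀
    exact hg₀
  obtain ⟨_, ⟨q, k, rfl⟩, hqk, hsub⟩ :=
    (PiNat.isTopologicalBasis_cylinders (fun _ => ℕ)).exists_subset_of_mem_open hg₀U hU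
  rw [PiNat.mem_cylinder_iff_eq] at hqk
  rw [← hqk] at hsub
  -- The interior point `g₀` may lie outside `K`, but its cylinder meets `K`.
  obtain ⟨p, hpK, hpg⟩ := exists_initList_eq_of_mem_closure g₀.2 k
  refine ⟨c, k, p, hpK, fun g hg hgp => ?_⟩
  have hgU : g ∈ U := hsub fun i hi => by
    have := congrArg (·[i]?) (hgp.trans hpg)
    simpa only [getElem?_initList hi, Option.some_inj] using this
  have hgS : (⟨g, subset_closure hg⟩ : closure K) ∈ closure (S c) := by
    refine interior_subset ?_
    rw [← hUeq]
    exact hgU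
  rw [closure_subtype] at hgS
  refine closure_mono ?_ hgS
  rintro _ ⟨g', hg', rfl⟩
  exact ⟨g'.2, hg'⟩

/-- If a `Π⁰₁` class has an element computable from `X` and all its elements compute `X`, then `X`
is a `Π⁰₄` singleton. -/
theorem isPiSingleton_of_forall_mem_treeClass {D : ℕ → List ℕ → Bool} (hD : Computable₂ D)
    {X : Set ℕ} {h : ℕ → ℕ} (hC : h ∈ treeClass D) (hX : degFun h ≤ degSet X)
    (hle : ∀ g ∈ treeClass D, degSet X ≤ degFun g) : IsPiSingleton 4 X := by
  let K : Set (ℕ → ℕ) := {g | g ∈ treeClass D ∧ degFun g ≤ degSet X}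
  have hKC : closure K ⊆ treeClass D := fun g hg m k => by
    obtain ⟨g', hg', he⟩ := exists_initList_eq_of_mem_closure hg k
    rw [← he]
    exact hg'.1 m k
  obtain ⟨c, k, p, hp, hdense⟩ := exists_program_dense (K := K) (f := charFun X) ⟨h, hC, hX⟩
    fun g hg => exists_oracleComputes (hle g (hKC hg))
  obtain ⟨D', hD', hD'C⟩ := exists_treeClass_inter_cylinder hD p k
  refine isPiSingleton_of_treeClass hD' ((hD'C p).2 ⟨hp.1, rfl⟩) hp.2
    (fun g hg => hle g ((hD'C g).1 hg).1) c ?_ ?_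
  -- An output depends only on a finite string, which is shared with a function from which `c`
  -- computes `X` correctly.
  · intro g hg hgX n j v hv
    obtain ⟨g', ⟨-, hg'⟩, he⟩ := exists_initList_eq_of_mem_closure
      (hdense g ⟨((hD'C g).1 hg).1, hgX⟩ ((hD'C g).1 hg).2) j
    rw [← he] at hv
    exact hg'.2 n j v hv
  · intro n
    obtain ⟨g, ⟨hgK, hg⟩, he⟩ := exists_initList_eq_of_mem_closure (hdense p hp rfl) k
    obtain ⟨j, hj⟩ := hg.1 n
    -- `g` lies only in the closure of `K` and may not be computable from `X`. It is replaced by an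
    -- element of `K` sharing both the string used and the cylinder.
    obtain ⟨g', hg', he'⟩ := exists_initList_eq_of_mem_closure hgK (max j k)
    refine ⟨g', (hD'C g').2 ⟨hg'.1, ?_⟩, hg'.2, j, ?_⟩
    · exact (initList_eq_of_le he' (le_max_right j k)).trans he
    · rw [initList_eq_of_le he' (le_max_left j k), hj]

-- Isomorphisms as a `Π⁰₁` class

theorem getD_initList (g : ℕ → ℕ) (k x : ℕ) :
    (initList g k).getD x 0 = if x < k then g x else 0 := by
  split_ifs with h
  · simp [List.getD_eq_getElem?_getD, getElem?_initList h]
  · rw [List.getD_eq_default _ _ (by simpa using h)]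

/-- The data of a computable structure, in terms of computable functions on numbers and lists. -/
structure StructureData where
  dom : ℕ → Bool
  fn : ℕ → List ℕ → ℕ
  rel : ℕ → List ℕ → Bool
  computable_dom : Computable dom
  computable_fn : Computable₂ fn
  computable_rel : Computable₂ rel

/-- The image of a list under the first component of a string of pairs, with values shifted by one
so that `0` stands for an undefined value. -/
def imageList (ρ l : List ℕ) : List ℕ := l.map fun x => (ρ.getD x 0).unpair.1

theorem primrec_imageList : Primrec₂ imageList :=
  Primrec.list_map Primrec.snd (Primrec.fst.comp (Primrec.unpair.comp
    ((Primrec.list_getD 0).comp (Primrec.fst.comp Primrec.fst) Primrec.snd)))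

/-- Tests on initial segments of `g` which express that `g` codes an isomorphism together with its
inverse: if `g n = ⟨a, b⟩` then `a` is `0` or one more than the image of `n`, and `b` is `0` or one
more than the preimage of `n`. -/
def isoTest (dF dR : ℕ → Bool) (aF aR : ℕ → ℕ) (A B : StructureData) (m : ℕ) (ρ : List ℕ) : Bool :=
  let fw : ℕ → ℕ := fun n => (ρ.getD n 0).unpair.1
  let bw : ℕ → ℕ := fun n => (ρ.getD n 0).unpair.2
  let s := m.unpair.1
  let l := Denumerable.ofNat (List ℕ) m.unpair.2
  let l' := imageList ρ l
  (decide (ρ.length ≤ m) || decide (decide (fw m = 0) = !A.dom m)) &&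
  ((decide (ρ.length ≤ m) || decide (decide (bw m = 0) = !B.dom m)) &&
  ((decide (fw m = 0) || (decide (ρ.length ≤ fw m - 1) || decide (bw (fw m - 1) = m + 1))) &&
  ((decide (bw m = 0) || (decide (ρ.length ≤ bw m - 1) || decide (fw (bw m - 1) = m + 1))) &&
  (((!dF s || (!decide (l.length = aF s) || decide (l'.idxOf 0 < l'.length))) ||
    (decide (ρ.length ≤ A.fn s l) || decide (fw (A.fn s l) = B.fn s (l'.map Nat.pred) + 1))) &&
  ((!dR s || (!decide (l.length = aR s) || decide (l'.idxOf 0 < l'.length))) ||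
    decide (A.rel s l = B.rel s (l'.map Nat.pred)))))))

theorem computable_isoTest {dF dR : ℕ → Bool} {aF aR : ℕ → ℕ} (hdF : Computable dF)
    (hdR : Computable dR) (haF : Computable aF) (haR : Computable aR) (A B : StructureData) :
    Computable₂ (isoTest dF dR aF aR A B) := by
  have hρ : Computable fun p : ℕ × List ℕ => p.2 := Computable.snd
  have hm : Computable fun p : ℕ × List ℕ => p.1 := Computable.fst
  have hlen : Computable fun p : ℕ × List ℕ => p.2.length := Computable.list_length.comp hρ
  have hfw {f : ℕ × List ℕ → ℕ} (hf : Computable f) :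
      Computable fun p : ℕ × List ℕ => (p.2.getD (f p) 0).unpair.1 :=
    Computable.fst.comp (Computable.unpair.comp ((Primrec.list_getD 0).to_comp.comp hρ hf))
  have hbw {f : ℕ × List ℕ → ℕ} (hf : Computable f) :
      Computable fun p : ℕ × List ℕ => (p.2.getD (f p) 0).unpair.2 :=
    Computable.snd.comp (Computable.unpair.comp ((Primrec.list_getD 0).to_comp.comp hρ hf))
  have hs : Computable fun p : ℕ × List ℕ => p.1.unpair.1 :=
    Computable.fst.comp (Computable.unpair.comp hm)
  have hl : Computable fun p : ℕ × List ℕ => Denumerable.ofNat (List ℕ) p.1.unpair.2 :=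
    (Primrec.ofNat _).to_comp.comp (Computable.snd.comp (Computable.unpair.comp hm))
  have hl' := primrec_imageList.to_comp.comp hρ hl
  have hpred : Computable fun p : ℕ × List ℕ =>
      (imageList p.2 (Denumerable.ofNat (List ℕ) p.1.unpair.2)).map Nat.pred :=
    (Primrec.list_map Primrec.id (Primrec.pred.comp₂ Primrec₂.right)).to_comp.comp hl'
  have hidx := Primrec.nat_lt.decide.to_comp.comp
    (Primrec.list_idxOf.to_comp.comp (Computable.const 0) hl') (Computable.list_length.comp hl')
  have hsub {f : ℕ × List ℕ → ℕ} (hf : Computable f) : Computable fun p => f p - 1 :=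
    Primrec.nat_sub.to_comp.comp hf (Computable.const 1)
  have hle {f : ℕ × List ℕ → ℕ} (hf : Computable f) : 
      Computable fun p : ℕ × List ℕ => decide (p.2.length ≤ f p) :=
    Primrec.nat_le.decide.to_comp.comp hlen hf
  have heq {f g : ℕ × List ℕ → ℕ} (hf : Computable f) (hg : Computable g) :
      Computable fun p => decide (f p = g p) := Primrec.eq.decide.to_comp.comp hf hg
  have heqb {f g : ℕ × List ℕ → Bool} (hf : Computable f) (hg : Computable g) :
      Computable fun p => decide (f p = g p) := Primrec.eq.decide.to_comp.comp hf hg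
  have hor {f g : ℕ × List ℕ → Bool} (hf : Computable f) (hg : Computable g) :
      Computable fun p => f p || g p := Primrec.or.to_comp.comp hf hg
  have hand {f g : ℕ × List ℕ → Bool} (hf : Computable f) (hg : Computable g) :
      Computable fun p => f p && g p := Primrec.and.to_comp.comp hf hg
  have hnot {f : ℕ × List ℕ → Bool} (hf : Computable f) :
      Computable fun p => !f p := Primrec.not.to_comp.comp hf
  have h0 : Computable fun _ : ℕ × List ℕ => 0 := Computable.const 0
  have hsucc := Computable.succ.comp hm
  refine hand (hor (hle hm) (heqb (heq (hfw hm) h0) (hnot (A.computable_dom.comp hm))))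
    (hand (hor (hle hm) (heqb (heq (hbw hm) h0) (hnot (B.computable_dom.comp hm))))
    (hand (hor (heq (hfw hm) h0) (hor (hle (hsub (hfw hm))) (heq (hbw (hsub (hfw hm))) hsucc)))
    (hand (hor (heq (hbw hm) h0) (hor (hle (hsub (hbw hm))) (heq (hfw (hsub (hbw hm))) hsucc)))
    (hand (hor (hor (hnot (hdF.comp hs)) (hor (hnot (heq (Computable.list_length.comp hl)
      (haF.comp hs))) hidx)) (hor (hle (A.computable_fn.comp hs hl))
        (heq (hfw (A.computable_fn.comp hs hl))
          (Computable.succ.comp (B.computable_fn.comp hs hpred)))))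
    (hor (hor (hnot (hdR.comp hs)) (hor (hnot (heq (Computable.list_length.comp hl)
      (haR.comp hs))) hidx)) (heqb (A.computable_rel.comp hs hl)
        (B.computable_rel.comp hs hpred)))))))

/-- Each test passes when it needs a value beyond the end of the string: the length guards cover
some positions, and elsewhere the default `0` unpairs to `(0, 0)`, "undefined", as does the
condition `l'.idxOf 0 < l'.length` (an entry of `l` has no image yet). Conversely, a long enough
string makes the test effective. The number `m` serves both as an element and as a code of a symbol
and a tuple. -/
theorem mem_treeClass_isoTest {dF dR : ℕ → Bool} {aF aR : ℕ → ℕ} {A B : StructureData}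
    {g : ℕ → ℕ} : g ∈ treeClass (isoTest dF dR aF aR A B) ↔
      (∀ n, (g n).unpair.1 = 0 ↔ A.dom n = false) ∧ (∀ n, (g n).unpair.2 = 0 ↔ B.dom n = false) ∧
      (∀ n, (g n).unpair.1 ≠ 0 → (g ((g n).unpair.1 - 1)).unpair.2 = n + 1) ∧
      (∀ n, (g n).unpair.2 ≠ 0 → (g ((g n).unpair.2 - 1)).unpair.1 = n + 1) ∧
      (∀ s l, dF s = true → l.length = aF s → (∀ x ∈ l, (g x).unpair.1 ≠ 0) →
        (g (A.fn s l)).unpair.1 = B.fn s (l.map fun x => (g x).unpair.1 - 1) + 1) ∧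
      (∀ s l, dR s = true → l.length = aR s → (∀ x ∈ l, (g x).unpair.1 ≠ 0) →
        A.rel s l = B.rel s (l.map fun x => (g x).unpair.1 - 1)) := by
  have hu : Nat.unpair 0 = (0, 0) := Nat.unpair_zero
  have himage {k : ℕ} {l : List ℕ} (h : ∀ x ∈ l, x < k) :
      imageList (initList g k) l = l.map fun x => (g x).unpair.1 :=
    List.map_congr_left fun x hx => by rw [getD_initList, if_pos (h x hx)]
  have hbound (l : List ℕ) : ∃ k, ∀ x ∈ l, x < k :=
    ⟨l.toFinset.sup id + 1, fun x hx =>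
      Nat.lt_succ_of_le (Finset.le_sup (f := id) (List.mem_toFinset.2 hx))⟩
  simp only [treeClass, Set.mem_ofPred_eq, isoTest, Bool.and_eq_true, Bool.or_eq_true,
    decide_eq_true_eq, length_initList, getD_initList, List.idxOf_lt_length_iff,
    Bool.not_eq_true', decide_eq_false_iff_not]
  constructor
  · intro h
    refine ⟨fun n => ?_, fun n => ?_, fun n hn => ?_, fun n hn => ?_, fun s l hs hl hl' => ?_,
      fun s l hs hl hl' => ?_⟩
    · have := (h n (n + 1)).1.resolve_left (by omega)
      rw [if_pos (by omega)] at this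
      cases hd : A.dom n <;> simpa [hd] using this
    · have := (h n (n + 1)).2.1.resolve_left (by omega)
      rw [if_pos (by omega)] at this
      cases hd : B.dom n <;> simpa [hd] using this
    · have := (h n (n + (g n).unpair.1 + 1)).2.2.1
      rw [if_pos (by omega), if_pos (by omega)] at this
      exact (this.resolve_left hn).resolve_left (by omega)
    · have := (h n (n + (g n).unpair.2 + 1)).2.2.2.1
      rw [if_pos (by omega), if_pos (by omega)] at this
      exact (this.resolve_left hn).resolve_left (by omega)
    · obtain ⟨k, hk⟩ := hbound (A.fn s l :: l)
      have hk' : ∀ x ∈ l, x < k := fun x hx => hk x (List.mem_cons_of_mem _ hx)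
      have := (h (Nat.pair s (Encodable.encode l)) k).2.2.2.2.1
      simp only [Nat.unpair_pair, Denumerable.ofNat_encode, himage hk',
        if_pos (hk _ List.mem_cons_self), hs, hl, List.mem_map, not_true_eq_false, false_or,
        Bool.true_eq_false, List.map_map] at this
      exact (this.resolve_left fun ⟨x, hx, hx'⟩ => hl' x hx hx').resolve_left
        (not_le.2 (hk _ List.mem_cons_self))
    · obtain ⟨k, hk⟩ := hbound l
      have := (h (Nat.pair s (Encodable.encode l)) k).2.2.2.2.2
      simp only [Nat.unpair_pair, Denumerable.ofNat_encode, himage hk, hs, hl, List.mem_map,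
        not_true_eq_false, false_or, Bool.true_eq_false, List.map_map] at this
      exact this.resolve_left fun ⟨x, hx, hx'⟩ => hl' x hx hx'
  · rintro ⟨h1, h2, h3, h4, h5, h6⟩ m k
    have hcase {l : List ℕ} (h0 : 0 ∉ imageList (initList g k) l) :
        (∀ x ∈ l, x < k) ∧ ∀ x ∈ l, (g x).unpair.1 ≠ 0 := by
      have : ∀ x ∈ l, x < k ∧ (g x).unpair.1 ≠ 0 := fun x hx => by
        by_contra hcon
        refine h0 (List.mem_map.2 ⟨x, hx, ?_⟩)
        rw [getD_initList]
        split_ifs with hxk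
        · by_contra hne
          exact hcon ⟨hxk, hne⟩
        · simp
      exact ⟨fun x hx => (this x hx).1, fun x hx => (this x hx).2⟩
    refine ⟨?_, ?_, ?_, ?_, ?_, ?_⟩
    · by_cases hm : k ≤ m
      · exact .inl hm
      · rw [if_pos (not_le.1 hm)]
        have := h1 m
        cases hd : A.dom m <;> simp_all
    · by_cases hm : k ≤ m
      · exact .inl hm
      · rw [if_pos (not_le.1 hm)]
        have := h2 m
        cases hd : B.dom m <;> simp_all
    · by_cases hm : m < k
      · rw [if_pos hm]
        by_cases h0 : (g m).unpair.1 = 0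
        · exact .inl h0
        · by_cases hle : k ≤ (g m).unpair.1 - 1
          · exact .inr (.inl hle)
          · rw [if_pos (not_le.1 hle)]
            exact .inr (.inr (h3 m h0))
      · rw [if_neg hm]
        simp
    · by_cases hm : m < k
      · rw [if_pos hm]
        by_cases h0 : (g m).unpair.2 = 0
        · exact .inl h0
        · by_cases hle : k ≤ (g m).unpair.2 - 1
          · exact .inr (.inl hle)
          · rw [if_pos (not_le.1 hle)]
            exact .inr (.inr (h4 m h0))
      · rw [if_neg hm]
        simp
    · generalize m.unpair.1 = s, Denumerable.ofNat (List ℕ) m.unpair.2 = l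
      by_contra hcon
      simp only [not_or, not_not, Bool.not_eq_false, not_le] at hcon
      obtain ⟨⟨hs, hl, h0⟩, hlt, hne⟩ := hcon
      obtain ⟨hlk, hl0⟩ := hcase h0
      rw [if_pos hlt, himage hlk, List.map_map] at hne
      exact hne (h5 s l hs hl hl0)
    · generalize m.unpair.1 = s, Denumerable.ofNat (List ℕ) m.unpair.2 = l
      by_contra hcon
      simp only [not_or, not_not, Bool.not_eq_false] at hcon
      obtain ⟨⟨hs, hl, h0⟩, hne⟩ := hcon
      obtain ⟨hlk, hl0⟩ := hcase h0
      rw [himage hlk, List.map_map] at hne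
      exact hne (h6 s l hs hl hl0)

-- Degrees of isomorphisms and of their codes

theorem degFun_comp_le {u v o : ℕ → ℕ} (hu : degFun u ≤ degFun o) (hv : degFun v ≤ degFun o) :
    degFun (fun n => u (v n)) ≤ degFun o :=
  degFun_le_degFun.2 (RecursiveIn.iff_nat.2 ((RecursiveIn.iff_nat.1
    (degFun_le_degFun.1 hu)).comp_total (RecursiveIn.iff_nat.1 (degFun_le_degFun.1 hv))))

theorem degFun_computable_comp_le {u v o : ℕ → ℕ} {H : ℕ → ℕ × ℕ → ℕ} (hH : Computable₂ H)
    (hu : degFun u ≤ degFun o) (hv : degFun v ≤ degFun o) :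
    degFun (fun n => H n (u n, v n)) ≤ degFun o := by
  have hu' := RecursiveIn.iff_nat.1 (degFun_le_degFun.1 hu)
  have hv' := RecursiveIn.iff_nat.1 (degFun_le_degFun.1 hv)
  have hH' : Computable fun p : ℕ => H p.unpair.1 p.unpair.2.unpair :=
    hH.comp (Computable.fst.comp Computable.unpair)
      (Computable.unpair.comp (Computable.snd.comp Computable.unpair))
  refine degFun_le_degFun.2 (RecursiveIn.iff_nat.2 (((Nat.RecursiveIn.of_computable hH').comp_total
    ((Nat.RecursiveIn.of_computable Computable.id).pair_total (hu'.pair_total hv'))).of_eq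
    fun n => ?_))
  simp

namespace ComputableStructure

variable {V : ComputableVocabulary}

/-- The data `d` decides and computes the domain, functions and relations of `A`. -/
structure Presents (d : StructureData) (A : ComputableStructure V) : Prop where
  dom : ∀ n, d.dom n = true ↔ n ∈ A.carrier
  fn : ∀ (n : ℕ) (s : V.lang.Functions n) (x : Fin n → A.carrier),
    d.fn s.1 (List.ofFn fun i => (x i : ℕ)) = (A.str.funMap s x : ℕ)
  rel : ∀ (n : ℕ) (s : V.lang.Relations n) (x : Fin n → A.carrier),
    d.rel s.1 (List.ofFn fun i => (x i : ℕ)) = true ↔ A.str.RelMap s x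

theorem exists_presents (A : ComputableStructure V) : ∃ d, Presents d A := by
  obtain ⟨dom, hdom, hdom'⟩ := ComputablePred.computable_iff.1 A.computable_carrier
  obtain ⟨F, hF, hF'⟩ := A.computable_fun
  obtain ⟨R, hR, hR'⟩ := A.computable_rel
  exact ⟨⟨dom, F, R, hdom, hF, hR⟩, fun n => (iff_of_eq (congrFun hdom' n)).symm, hF', hR'⟩

variable {A B C : ComputableStructure V}

theorem Iso.toNatFun_of_mem (f : A.Iso B) {n : ℕ} (h : n ∈ A.carrier) :
    f.toNatFun n = f ⟨n, h⟩ := dif_pos h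

theorem Iso.toNatFun_of_notMem (f : A.Iso B) {n : ℕ} (h : n ∉ A.carrier) :
    f.toNatFun n = 0 := dif_neg h

theorem Iso.toNatFun_mem (f : A.Iso B) {n : ℕ} (h : n ∈ A.carrier) :
    f.toNatFun n ∈ B.carrier := by
  rw [f.toNatFun_of_mem h]
  exact (f ⟨n, h⟩).2

theorem Iso.symm_toNatFun_toNatFun (f : A.Iso B) {n : ℕ} (h : n ∈ A.carrier) :
    Iso.toNatFun (FirstOrder.Language.Equiv.symm f) (f.toNatFun n) = n := by
  rw [Iso.toNatFun_of_mem _ (f.toNatFun_mem h)]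
  have : (⟨f.toNatFun n, f.toNatFun_mem h⟩ : B.carrier) = f ⟨n, h⟩ :=
    Subtype.ext (f.toNatFun_of_mem h)
  rw [this, FirstOrder.Language.Equiv.symm_apply_apply]

theorem Iso.toNatFun_symm_toNatFun (f : A.Iso B) {n : ℕ} (h : n ∈ B.carrier) :
    f.toNatFun (Iso.toNatFun (FirstOrder.Language.Equiv.symm f) n) = n := by
  have := Iso.symm_toNatFun_toNatFun (FirstOrder.Language.Equiv.symm f : B.Iso A) h
  rwa [FirstOrder.Language.Equiv.symm_symm] at this

/-- Search for a preimage, the candidate being the first component of the string's length.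
Candidates must be checked to lie in `A`, since the junk value `0` off `A` could equal `n`. -/
theorem Iso.degFun_symm_le (f : A.Iso B) :
    degFun (Iso.toNatFun (FirstOrder.Language.Equiv.symm f)) ≤ degFun f.toNatFun := by
  obtain ⟨dA, hA⟩ := A.exists_presents
  obtain ⟨dB, hB⟩ := B.exists_presents
  refine degFun_le_of_computable (φ := fun n ρ => bif dB.dom n then
    (bif dA.dom ρ.length.unpair.1 && decide (ρ[ρ.length.unpair.1]? = some n) then
      some ρ.length.unpair.1 else none) else some 0) ?_ ?_ ?_
  · have hm : Computable fun p : ℕ × List ℕ => p.2.length.unpair.1 :=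
      Computable.fst.comp (Computable.unpair.comp (Computable.list_length.comp Computable.snd))
    refine Computable.cond (dB.computable_dom.comp Computable.fst) (Computable.cond
      (Primrec.and.to_comp.comp (dA.computable_dom.comp hm) ?_) (Computable.option_some.comp hm)
      (Computable.const none)) (Computable.const (some 0))
    exact Primrec.eq.decide.to_comp.comp (Computable.list_getElem?.comp Computable.snd hm)
      (Computable.option_some.comp Computable.fst)
  · intro n
    by_cases h : n ∈ B.carrier
    · have hfm := f.toNatFun_symm_toNatFun h
      have hmA := Iso.toNatFun_mem (FirstOrder.Language.Equiv.symm f : B.Iso A) h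
      generalize Iso.toNatFun (FirstOrder.Language.Equiv.symm f) n = m at hfm hmA ⊢
      -- The second component `m + 1` makes the string long enough to contain position `m`.
      have hlt : m < Nat.pair m (m + 1) :=
        Nat.lt_of_lt_of_le (Nat.lt_succ_self m) (Nat.right_le_pair m (m + 1))
      refine ⟨Nat.pair m (m + 1), ?_⟩
      simp only [(hB.dom n).2 h, length_initList, Nat.unpair_pair, (hA.dom m).2 hmA,
        getElem?_initList hlt, hfm, decide_true, Bool.and_self, cond_true]
    · refine ⟨0, ?_⟩
      have : dB.dom n = false := Bool.eq_false_iff.2 (mt (hB.dom n).1 h)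
      simp [this, Iso.toNatFun_of_notMem (FirstOrder.Language.Equiv.symm f : B.Iso A) h]
  · intro n k v hv
    by_cases h : n ∈ B.carrier
    · rw [(hB.dom n).2 h, cond_true, Bool.cond_eq_ite] at hv
      split_ifs at hv with hc
      rw [Bool.and_eq_true, decide_eq_true_eq, hA.dom] at hc
      obtain ⟨-, hn⟩ := getElem?_initList_eq_some hc.2
      rw [hn, f.symm_toNatFun_toNatFun hc.1, Option.some_inj.1 hv]
    · have : dB.dom n = false := Bool.eq_false_iff.2 (mt (hB.dom n).1 h)
      rw [this, cond_false, Option.some_inj] at hv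
      rw [← hv, Iso.toNatFun_of_notMem (FirstOrder.Language.Equiv.symm f : B.Iso A) h]

/-- Composing the functions on numbers gives `g.toNatFun 0` off `A`, which need not be `0`; the
domain of `A` is therefore consulted as well. -/
theorem Iso.degFun_comp_le (g : B.Iso C) (f : A.Iso B) {o : ℕ → ℕ}
    (hg : degFun g.toNatFun ≤ degFun o) (hf : degFun f.toNatFun ≤ degFun o) :
    degFun (Iso.toNatFun (FirstOrder.Language.Equiv.comp g f : A.Iso C)) ≤ degFun o := by
  obtain ⟨dA, hA⟩ := A.exists_presents
  have hH : Computable₂ fun (n : ℕ) (q : ℕ × ℕ) => bif dA.dom n then q.1 else 0 :=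
    Computable.cond (dA.computable_dom.comp Computable.fst) (Computable.fst.comp Computable.snd)
      (Computable.const 0)
  have hgf := _root_.degFun_comp_le hg hf
  convert degFun_computable_comp_le hH hgf hgf using 2
  ext n
  by_cases h : n ∈ A.carrier
  · rw [(hA.dom n).2 h, cond_true, Iso.toNatFun_of_mem _ h, g.toNatFun_of_mem (f.toNatFun_mem h)]
    rw [FirstOrder.Language.Equiv.comp_apply]
    congr 2
    exact Subtype.ext (f.toNatFun_of_mem h).symm
  · rw [Bool.eq_false_iff.2 (mt (hA.dom n).1 h), cond_false, Iso.toNatFun_of_notMem _ h]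

open Classical in
/-- An isomorphism together with its inverse, as a function on numbers. -/
noncomputable def Iso.path (f : A.Iso B) (n : ℕ) : ℕ :=
  Nat.pair (if n ∈ A.carrier then f.toNatFun n + 1 else 0)
    (if n ∈ B.carrier then Iso.toNatFun (FirstOrder.Language.Equiv.symm f) n + 1 else 0)

theorem Iso.degFun_path_le (f : A.Iso B) : degFun f.path ≤ degFun f.toNatFun := by
  obtain ⟨dA, hA⟩ := A.exists_presents
  obtain ⟨dB, hB⟩ := B.exists_presents
  have hH : Computable₂ fun (n : ℕ) (q : ℕ × ℕ) =>
      Nat.pair (bif dA.dom n then q.1 + 1 else 0) (bif dB.dom n then q.2 + 1 else 0) :=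
    Primrec₂.natPair.to_comp.comp
      (Computable.cond (dA.computable_dom.comp Computable.fst)
        (Computable.succ.comp (Computable.fst.comp Computable.snd)) (Computable.const 0))
      (Computable.cond (dB.computable_dom.comp Computable.fst)
        (Computable.succ.comp (Computable.snd.comp Computable.snd)) (Computable.const 0))
  convert degFun_computable_comp_le hH le_rfl f.degFun_symm_le using 2
  ext n
  simp only [Iso.path, ← hA.dom, ← hB.dom, Bool.cond_eq_ite]

theorem exists_tuple {l : List ℕ} (h : ∀ x ∈ l, x ∈ A.carrier) :
    ∃ x : Fin l.length → A.carrier, (List.ofFn fun i => (x i : ℕ)) = l :=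
  ⟨fun i => ⟨l.get i, h _ (l.get_mem i)⟩, List.ofFn_get l⟩

variable {dA dB : StructureData} {dF dR : ℕ → Bool}

theorem Iso.path_mem_treeClass (hA : Presents dA A) (hB : Presents dB B)
    (hF : ∀ s, dF s = true ↔ s ∈ V.funSymb) (hR : ∀ s, dR s = true ↔ s ∈ V.relSymb)
    (f : A.Iso B) : f.path ∈ treeClass (isoTest dF dR V.funArity V.relArity dA dB) := by
  have hA' (n : ℕ) : dA.dom n = false ↔ n ∉ A.carrier := by rw [← hA.dom, Bool.not_eq_true]
  have hB' (n : ℕ) : dB.dom n = false ↔ n ∉ B.carrier := by rw [← hB.dom, Bool.not_eq_true]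
  have hfst {n : ℕ} (h : n ∈ A.carrier) : (f.path n).unpair.1 = f.toNatFun n + 1 := by
    simp [Iso.path, h]
  have hsnd {n : ℕ} (h : n ∈ B.carrier) : (f.path n).unpair.2 =
      Iso.toNatFun (FirstOrder.Language.Equiv.symm f) n + 1 := by simp [Iso.path, h]
  have hfst' {n : ℕ} : (f.path n).unpair.1 = 0 ↔ n ∉ A.carrier := by
    by_cases h : n ∈ A.carrier <;> simp [Iso.path, h]
  have hsnd' {n : ℕ} : (f.path n).unpair.2 = 0 ↔ n ∉ B.carrier := by
    by_cases h : n ∈ B.carrier <;> simp [Iso.path, h]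
  have htuple {n : ℕ} (x : Fin n → A.carrier) :
      ((List.ofFn fun i => (x i : ℕ)).map fun y => (f.path y).unpair.1 - 1) =
        List.ofFn fun i => (f (x i) : ℕ) := by
    rw [List.map_ofFn]
    congr 1
    ext i
    simp [hfst (x i).2, f.toNatFun_of_mem (x i).2]
  refine mem_treeClass_isoTest.2 ⟨fun n => ?_, fun n => ?_, fun n hn => ?_, fun n hn => ?_,
    fun s l hs hl hl' => ?_, fun s l hs hl hl' => ?_⟩
  · rw [hfst', hA']
  · rw [hsnd', hB']
  · have h : n ∈ A.carrier := not_not.1 (mt hfst'.2 hn)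
    rw [hfst h, Nat.add_sub_cancel, hsnd (f.toNatFun_mem h), f.symm_toNatFun_toNatFun h]
  · have h : n ∈ B.carrier := not_not.1 (mt hsnd'.2 hn)
    rw [hsnd h, Nat.add_sub_cancel,
      hfst (Iso.toNatFun_mem (FirstOrder.Language.Equiv.symm f : B.Iso A) h),
      f.toNatFun_symm_toNatFun h]
  · obtain ⟨x, hx⟩ := exists_tuple (A := A) (l := l) fun y hy => not_not.1 (mt hfst'.2 (hl' y hy))
    let s' : V.lang.Functions l.length := ⟨s, (hF s).1 hs, hl.symm⟩
    have h1 := hA.fn _ s' x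
    have h2 := hB.fn _ s' fun i => f (x i)
    have h3 := htuple x
    rw [hx] at h1 h3
    rw [h3, h2, h1, hfst (A.str.funMap s' x).2, f.toNatFun_of_mem (A.str.funMap s' x).2]
    exact congrArg (fun z : B.carrier => (z : ℕ) + 1)
      (FirstOrder.Language.Equiv.map_fun f s' x)
  · obtain ⟨x, hx⟩ := exists_tuple (A := A) (l := l) fun y hy => not_not.1 (mt hfst'.2 (hl' y hy))
    let s' : V.lang.Relations l.length := ⟨s, (hR s).1 hs, hl.symm⟩
    have h1 := hA.rel _ s' x
    have h2 := hB.rel _ s' fun i => f (x i)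
    have h3 := htuple x
    rw [hx] at h1 h3
    rw [h3, Bool.eq_iff_iff]
    exact h1.trans ((FirstOrder.Language.Equiv.map_rel f s' x).symm.trans h2.symm)

theorem exists_iso_of_mem_treeClass (hA : Presents dA A) (hB : Presents dB B)
    (hF : ∀ s, dF s = true ↔ s ∈ V.funSymb) (hR : ∀ s, dR s = true ↔ s ∈ V.relSymb) {g : ℕ → ℕ}
    (hg : g ∈ treeClass (isoTest dF dR V.funArity V.relArity dA dB)) :
    ∃ f : A.Iso B, degFun f.toNatFun ≤ degFun g := by
  obtain ⟨h1, h2, h3, h4, h5, h6⟩ := mem_treeClass_isoTest.1 hg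
  have hfst {n : ℕ} : (g n).unpair.1 ≠ 0 ↔ n ∈ A.carrier := by
    rw [Ne, h1, ← hA.dom, Bool.not_eq_false]
  have hsnd {n : ℕ} : (g n).unpair.2 ≠ 0 ↔ n ∈ B.carrier := by
    rw [Ne, h2, ← hB.dom, Bool.not_eq_false]
  let e : A.carrier ≃ B.carrier :=
    { toFun := fun n => ⟨(g n).unpair.1 - 1, hsnd.1 (by rw [h3 n (hfst.2 n.2)]; omega)⟩
      invFun := fun n => ⟨(g n).unpair.2 - 1, hfst.1 (by rw [h4 n (hsnd.2 n.2)]; omega)⟩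
      left_inv := fun n => Subtype.ext (by simp [h3 n (hfst.2 n.2)])
      right_inv := fun n => Subtype.ext (by simp [h4 n (hsnd.2 n.2)]) }
  have htuple {n : ℕ} (x : Fin n → A.carrier) :
      ((List.ofFn fun i => (x i : ℕ)).map fun y => (g y).unpair.1 - 1) =
        List.ofFn fun i => (e (x i) : ℕ) := by
    rw [List.map_ofFn]
    rfl
  have hne {n : ℕ} (x : Fin n → A.carrier) :
      ∀ y ∈ List.ofFn fun i => (x i : ℕ), (g y).unpair.1 ≠ 0 := fun y hy => by
    obtain ⟨i, rfl⟩ := (List.mem_ofFn' _ _).1 hy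
    exact hfst.2 (x i).2
  let f : A.Iso B :=
    { e with
      map_fun' := fun {n} s x => by
        have := h5 s.1 (List.ofFn fun i => (x i : ℕ)) ((hF _).2 s.2.1)
          (by rw [List.length_ofFn, s.2.2]) (hne x)
        rw [htuple, hA.fn, hB.fn n s fun i => e (x i)] at this
        refine Subtype.ext ?_
        change (g _).unpair.1 - 1 = _
        rw [this, Nat.add_sub_cancel]
        rfl
      map_rel' := fun {n} s x => by
        have := h6 s.1 (List.ofFn fun i => (x i : ℕ)) ((hR _).2 s.2.1)
          (by rw [List.length_ofFn, s.2.2]) (hne x)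
        rw [htuple, Bool.eq_iff_iff, hA.rel, hB.rel n s fun i => e (x i)] at this
        exact this.symm }
  refine ⟨f, degFun_le_of_computable (φ := fun n ρ => ρ[n]?.map fun v => v.unpair.1 - 1) ?_ ?_ ?_⟩
  · exact Computable.option_map (Computable.list_getElem?.comp Computable.snd Computable.fst)
      (Primrec.nat_sub.comp (Primrec.fst.comp (Primrec.unpair.comp Primrec.snd))
        (Primrec.const 1)).to_comp
  all_goals
    -- Off `A` the first component is `0`, and truncated subtraction gives `0`, the value of
    -- `f.toNatFun` there.
    have hval (n : ℕ) : (g n).unpair.1 - 1 = f.toNatFun n := by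
      by_cases h : n ∈ A.carrier
      · rw [f.toNatFun_of_mem h]
        rfl
      · rw [f.toNatFun_of_notMem h, not_not.1 (mt hfst.1 h)]
  · exact fun n => ⟨n + 1, by
      rw [getElem?_initList (Nat.lt_succ_self n), Option.map_some, hval]⟩
  · intro n k v hv
    obtain ⟨w, hw, rfl⟩ := Option.map_eq_some_iff.1 hv
    rw [(getElem?_initList_eq_some hw).2, hval]

end ComputableStructure

-- Conclusion

theorem mainTheorem12 (d : TuringDegree) (hd : IsStrongDegreeOfCategoricity d) :
    ∃ X : Set ℕ, degSet X = d ∧ IsPiSingleton 4 X := by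
  obtain ⟨V, A, A₀, A₁, h₀, h₁, ⟨hmem, -⟩, hle⟩ := hd
  obtain ⟨X, rfl, f₀, hf₀⟩ := Set.mem_iInter₂.1 hmem A₀ h₀
  obtain ⟨X₁, hX₁, f₁, hf₁⟩ := Set.mem_iInter₂.1 hmem A₁ h₁
  rw [hX₁] at hf₁
  refine ⟨X, rfl, ?_⟩
  obtain ⟨dA, hA⟩ := A₀.exists_presents
  obtain ⟨dB, hB⟩ := A₁.exists_presents
  obtain ⟨dF, hdF, hdF'⟩ := ComputablePred.computable_iff.1 V.computable_funSymb
  obtain ⟨dR, hdR, hdR'⟩ := ComputablePred.computable_iff.1 V.computable_relSymb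
  have hF (s : ℕ) : dF s = true ↔ s ∈ V.funSymb := (iff_of_eq (congrFun hdF' s)).symm
  have hR (s : ℕ) : dR s = true ↔ s ∈ V.relSymb := (iff_of_eq (congrFun hdR' s)).symm
  -- The spectrum of `A` bounds isomorphisms out of `A`; going through `A` gives one from `A₀` to
  -- `A₁` computable from `X`, and its `path` is the required element of the class.
  let f : A₀.Iso A₁ := FirstOrder.Language.Equiv.comp f₁ (FirstOrder.Language.Equiv.symm f₀)
  have hf : degFun f.toNatFun ≤ degSet X :=
    ComputableStructure.Iso.degFun_comp_le f₁ (FirstOrder.Language.Equiv.symm f₀ : A₀.Iso A) hf₁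
      (f₀.degFun_symm_le.trans hf₀)
  refine isPiSingleton_of_forall_mem_treeClass (computable_isoTest hdF hdR V.computable_funArity
    V.computable_relArity dA dB) (f.path_mem_treeClass hA hB hF hR)
    (f.degFun_path_le.trans hf) fun g hg => ?_
  obtain ⟨f', hf'⟩ := ComputableStructure.exists_iso_of_mem_treeClass hA hB hF hR hg
  exact (hle f').trans hf'
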